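/- Let $A$ be a real $n\times n$ matrix that is entrywise nonnegative and irreducible. (A square matrix is reducible if a simultaneous permutation of its rows and columns brings it to the form $\begin{pmatrix}A_1&0\\B&A_2\end{pmatrix}$ with square blocks $A_1,A_2$ of positive size, and irreducible otherwise.) Let $A^{(2)}$ be its second compound matrix, i.e. the $\binom n2\times\binom n2$ matrix of the minors of $A$ with rows $i<j$ and columns $k<l$, indexed by the pairs $(i,j)$ with $i<j$ and $(k,l)$ with $k<l$. Suppose that $A^{(2)}$ is irreducible and $\mathcal J$-sign-symmetric for a set $\mathcal J$ of such pairs, that is, $a^{(2)}_{\alpha\beta}\le 0$ whenever exactly one of $\alpha,\beta$ lies in $\mathcal J$, and $a^{(2)}_{\alpha\beta}<0$ only if exactly one of $\alpha,\beta$ lies in $\mathcal J$. Let $W\subseteq\{1,\dots,n\}^2$ be the set that consists of the diagonal pairs $(i,i)$, the pairs $(i,j)$ with $i<j$ and $(i,j)\in\mathcal J$, and the pairs $(i,j)$ with $i>j$ and $(j,i)\notin\mathcal J$. Suppose that $W$ is not transitive, i.e. that the relation $(i,j)\in W$ is not a linear order on $\{1,\dots,n\}$. Then the spectral radius $\rho(A)$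 is a positive eigenvalue of $A$ with an entrywise positive eigenvector. There are exactly three eigenvalues of $A$ on the circle $|\lambda|=\rho(A)$; each of them is (algebraically) simple, and they are the three complex cube roots of $\rho(A)^3$. Moreover $h(A)=h(A\wedge A)=3$, where $A\wedge A$ is the exterior square of the operator $A$ on $\mathbb R^n\wedge\mathbb R^n$ and $h(T)$ denotes the index of imprimitivity, the number of eigenvalues (counted with multiplicity) of $T$ equal in modulus to $\rho(T)$. -/

import Mathlib

open scoped Matrix TensorProduct

namespace SecondCompound

/-- A square matrix is reducible if some simultaneous permutation of rows and columns brings it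
to the block form `[[A₁, 0], [B, A₂]]` with `A₁` and `A₂` square of positive size. -/
def IsReducible {ι : Type*} (A : Matrix ι ι ℝ) : Prop :=
  ∃ (p q : ℕ) (e : Fin p ⊕ Fin q ≃ ι) (A₁ : Matrix (Fin p) (Fin p) ℝ)
    (B : Matrix (Fin q) (Fin p) ℝ) (A₂ : Matrix (Fin q) (Fin q) ℝ),
    0 < p ∧ 0 < q ∧ A.submatrix e e = Matrix.fromBlocks A₁ 0 B A₂

/-- `A` is `J`-sign-symmetric, with the set of indices `J` as a witness: every entry with exactly
one of its two indices in `J` is nonpositive, and an entry can be negative only if exactly one of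
its two indices is in `J`. -/
def IsSignSymmetricWith {ι : Type*} (A : Matrix ι ι ℝ) (J : Set ι) : Prop :=
  (∀ i j, ((i ∈ J ∧ j ∉ J) ∨ (i ∉ J ∧ j ∈ J)) → A i j ≤ 0) ∧
  (∀ i j, A i j < 0 → ((i ∈ J ∧ j ∉ J) ∨ (i ∉ J ∧ j ∈ J)))

/-- The pairs `(i, j)` with `i < j`, indexing the rows and columns of the second compound
matrix. -/
abbrev Pairs (n : ℕ) : Type := {p : Fin n × Fin n // p.1 < p.2}

/-- The second compound matrix: the `2 × 2` minors with rows `i < j` and columns `k < l`. -/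
def compound {n : ℕ} (A : Matrix (Fin n) (Fin n) ℝ) : Matrix (Pairs n) (Pairs n) ℝ :=
  fun p q => (A.submatrix ![p.1.1, p.1.2] ![q.1.1, q.1.2]).det

/-- The set `W ⊆ {1, …, n} × {1, …, n}` defined by a set `J` of pairs `i < j`. It contains the
diagonal and exactly one of `(i, j)`, `(j, i)` for all `i ≠ j`. -/
def wSet {n : ℕ} (J : Set (Pairs n)) : Set (Fin n × Fin n) :=
  {p | p.1 = p.2 ∨ (∃ h : p.1 < p.2, ⟨(p.1, p.2), h⟩ ∈ J) ∨
    (∃ h : p.2 < p.1, ⟨(p.2, p.1), h⟩ ∉ J)}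

/-- The binary relation `(i, j) ∈ W` is a linear order relation: reflexive, antisymmetric,
transitive and connected. -/
def IsLinearOrderRel {n : ℕ} (W : Set (Fin n × Fin n)) : Prop :=
  (∀ i, (i, i) ∈ W) ∧
  (∀ i j, (i, j) ∈ W → (j, i) ∈ W → i = j) ∧
  (∀ i j k, (i, j) ∈ W → (j, k) ∈ W → (i, k) ∈ W) ∧
  (∀ i j, (i, j) ∈ W ∨ (j, i) ∈ W)

section Spectrum

variable {V : Type*} [AddCommGroup V] [Module ℝ V] [Module.Finite ℝ V]

/-- The complex eigenvalues of a linear operator on a finite-dimensional real space, repeated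
according to algebraic multiplicity. -/
noncomputable def eigs (f : V →ₗ[ℝ] V) : Multiset ℂ := f.charpoly.aroots ℂ

/-- The spectral radius of a linear operator on a finite-dimensional real space, i.e. of its
complexification. -/
noncomputable def rho (f : V →ₗ[ℝ] V) : ℝ :=
  (spectralRadius ℂ (f.baseChange ℂ : Module.End ℂ (ℂ ⊗[ℝ] V))).toReal

open Classical in
/-- The eigenvalues on the spectral circle `|z| = ρ(f)`, repeated according to algebraic
multiplicity. -/
noncomputable def peripheral (f : V →ₗ[ℝ] V) : Multiset ℂ :=
  (eigs f).filter (fun z => ‖z‖ = rho f)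

/-- The index of imprimitivity: the number of eigenvalues equal in modulus to `ρ(f)`. -/
noncomputable def imprimitivityIndex (f : V →ₗ[ℝ] V) : ℕ := Multiset.card (peripheral f)

/-- The exterior square `f ∧ f`, with `(f ∧ f)(x ∧ y) = f x ∧ f y`. -/
noncomputable def exteriorSquare (f : V →ₗ[ℝ] V) : ⋀[ℝ]^2 V →ₗ[ℝ] ⋀[ℝ]^2 V :=
  exteriorPower.map 2 f

end Spectrum

end SecondCompound

open scoped Matrix TensorProduct

/-! Let ρ be the spectral radius of A and t the list of its eigenvalues, so that A^(2) has the
eigenvalues t_i t_j with i < j (`exists_aroots_charpoly_eq`). Conjugating A^(2) by the diagonal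
signs of J makes it nonnegative without changing its characteristic polynomial. Perron–Frobenius
theory therefore applies to both matrices: their peripheral eigenvalues are simple
(`count_eq_one_of_norm_eq_specRad`) and rotate the spectrum (`map_mul_aroots_charpoly`).

If ρ were the only peripheral eigenvalue of A, the spectral radius of A^(2) would be ρs with s a
real eigenvalue of A. For eigenvectors x > 0 at ρ and y at s, the wedge x ∧ y is then a Perron
vector of A^(2) up to the signs of J. So J records how the ratios y_k / x_k compare, and W is the
order by these ratios or its reverse (`isLinearOrderRel_of_peripheral_subset`), contrary to the
hypothesis.

So A has a second peripheral eigenvalue and ρ(A^(2)) = ρ². The peripheral eigenvalues divided by ρ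
form a group G. Simplicity for A^(2) says that a product of two distinct elements of G determines
the pair, and 1 is such a product because ρ² is an eigenvalue of A^(2). These facts leave only the
group of cube roots of unity (`mem_iff_pow_three_eq_one`). The products of two distinct cube roots
are again the three cube roots, which gives h(A ∧ A) = 3. -/

namespace SecondCompound

/-! ### Triangularization and characteristic roots -/

/-- An operator on a finite-dimensional space over an algebraically closed field is upper
triangular in some basis. -/
theorem exists_basis_isUpperTriangular {K : Type*} [Field K] [IsAlgClosed K] (n : ℕ) :
    ∀ {V : Type*} [AddCommGroup V] [Module K V] [FiniteDimensional K V]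
      (f : Module.End K V), Module.finrank K V = n →
      ∃ b : Module.Basis (Fin n) K V, (LinearMap.toMatrix b b f).IsUpperTriangular := by
  induction n with
  | zero =>
    intro V _ _ _ f hn
    exact ⟨Module.finBasisOfFinrankEq K V hn, fun i => i.elim0⟩
  | succ n ih =>
    intro V _ _ _ f hn
    have : Nontrivial V := Module.nontrivial_of_finrank_pos (R := K) (by omega)
    obtain ⟨c, hc⟩ := Module.End.exists_eigenvalue f
    -- A functional φ vanishing on the range of f - c satisfies φ ∘ f = cφ, so its kernel is an
    -- invariant hyperplane. A basis of it is completed by y as last vector.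
    have hlt : LinearMap.range (f - c • (1 : Module.End K V)) < ⊤ := by
      rw [lt_top_iff_ne_top, Ne, LinearMap.range_eq_top, ← LinearMap.injective_iff_surjective,
        ← LinearMap.ker_eq_bot]
      rw [← Module.End.eigenspace_def]
      exact Module.End.hasEigenvalue_iff.1 hc
    obtain ⟨φ, hφ0, hφ⟩ := Submodule.exists_le_ker_of_lt_top _ hlt
    obtain ⟨y, hy⟩ : ∃ y, φ y = 1 := by
      obtain ⟨z, hz⟩ : ∃ z, φ z ≠ 0 := by
        by_contra! h
        exact hφ0 (LinearMap.ext h)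
      exact ⟨(φ z)⁻¹ • z, by simp [hz]⟩
    have hmap : ∀ v, φ (f v) = c * φ v := by
      intro v
      have : φ ((f - c • (1 : Module.End K V)) v) = 0 := hφ ⟨v, rfl⟩
      simpa [sub_eq_zero] using this
    have hinv : ∀ v ∈ LinearMap.ker φ, f v ∈ LinearMap.ker φ := by
      intro v hv
      rw [LinearMap.mem_ker] at hv ⊢
      rw [hmap, hv, mul_zero]
    have hfin : Module.finrank K (LinearMap.ker φ) = n := by
      have h1 := LinearMap.finrank_range_add_finrank_ker φ
      have h2 : LinearMap.range φ = ⊤ := by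
        rw [LinearMap.range_eq_top]
        exact fun a => ⟨a • y, by simp [hy]⟩
      rw [h2, finrank_top, Module.finrank_self] at h1
      omega
    obtain ⟨b, hb⟩ := ih (f.restrict hinv) hfin
    let b' := Module.Basis.mkFinSnoc b y
      (by
        intro a x hx h
        have := congrArg φ h
        simpa [hy, LinearMap.mem_ker.1 hx] using this)
      (by
        intro z
        exact ⟨-φ z, by simp [hy]⟩)
    have hcast : ∀ i : Fin n, b' i.castSucc = b i := by
      intro i
      simp [b', Module.Basis.coe_mkFinSnoc]
    have hrepr : ∀ v : LinearMap.ker φ, ∀ i,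
        b'.repr (v : V) i = Fin.snoc (α := fun _ => K) (fun i => b.repr v i) 0 i := by
      intro v i
      have h1 : (v : V) = ∑ i, (b.repr v i) • b' i.castSucc := by
        calc (v : V) = ((∑ i, b.repr v i • b i : LinearMap.ker φ) : V) := by rw [b.sum_repr]
          _ = _ := by
            rw [Submodule.coe_sum]
            exact Finset.sum_congr rfl fun i _ => by rw [hcast]; rfl
      rw [h1, map_sum, Finsupp.finsetSum_apply]
      refine Fin.lastCases ?_ (fun j => ?_) i
      · simp [Fin.castSucc_ne_last]
      · simp [Finsupp.single_apply]
    refine ⟨b', fun i j hij => ?_⟩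
    have hij : j < i := hij
    rw [LinearMap.toMatrix_apply]
    obtain ⟨k, rfl⟩ : ∃ k : Fin n, j = k.castSucc :=
      ⟨j.castPred (ne_of_lt (lt_of_lt_of_le hij (Fin.le_last i))), by simp⟩
    rw [hcast, show f (b k) = ((f.restrict hinv) (b k) : V) from rfl, hrepr]
    refine Fin.lastCases (fun _ => by simp) (fun l hl => ?_) i hij
    have := hb (show id k < id l from by simpa using hl)
    rw [LinearMap.toMatrix_apply] at this
    simpa using this

/-- A square matrix over an algebraically closed field is similar to an upper triangular one. -/
theorem exists_similar_isUpperTriangular {K : Type*} [Field K] [IsAlgClosed K] {n : ℕ}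
    (M : Matrix (Fin n) (Fin n) K) :
    ∃ P Q T : Matrix (Fin n) (Fin n) K, Q * P = 1 ∧ M = P * (T * Q) ∧ T.IsUpperTriangular := by
  obtain ⟨b, hb⟩ := exists_basis_isUpperTriangular n (Matrix.toLin' M) (by simp)
  refine ⟨(Pi.basisFun K (Fin n)).toMatrix b, b.toMatrix (Pi.basisFun K (Fin n)), _, ?_, ?_, hb⟩
  · exact Module.Basis.toMatrix_mul_toMatrix_flip _ _
  · rw [← mul_assoc, basis_toMatrix_mul_linearMap_toMatrix_mul_basis_toMatrix,
      ← Matrix.toLin_eq_toLin', LinearMap.toMatrix_toLin]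

/-- The characteristic polynomial of a matrix that is upper triangular for a linear ordering of its
indices. -/
theorem charpoly_of_triangular {R ι α : Type*} [CommRing R] [Fintype ι] [DecidableEq ι]
    [LinearOrder α] (M : Matrix ι ι R) (f : ι → α) (hf : Function.Injective f)
    (h : ∀ i j, f j < f i → M i j = 0) :
    M.charpoly = ∏ i, (Polynomial.X - Polynomial.C (M i i)) := by
  let _ : LinearOrder ι := LinearOrder.lift' f hf
  exact Matrix.charpoly_of_isUpperTriangular M fun i j hij => h i j hij

theorem roots_charpoly_of_triangular {K ι α : Type*} [Field K] [Fintype ι] [DecidableEq ι]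
    [LinearOrder α] (M : Matrix ι ι K) (f : ι → α) (hf : Function.Injective f)
    (h : ∀ i j, f j < f i → M i j = 0) :
    M.charpoly.roots = Finset.univ.val.map fun i => M i i := by
  rw [charpoly_of_triangular M f hf h, Polynomial.roots_prod _ _
    (Finset.prod_ne_zero_iff.2 fun i _ => Polynomial.X_sub_C_ne_zero _)]
  simp [Multiset.bind_singleton]

/-- The eigenvalues of a scalar multiple of a matrix. -/
theorem roots_charpoly_smul {K ι : Type*} [Field K] [IsAlgClosed K] [Fintype ι] [DecidableEq ι]
    (M : Matrix ι ι K) (c : K) :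
    (c • M).charpoly.roots = M.charpoly.roots.map (c * ·) := by
  rw [← Matrix.charpoly_reindex (Fintype.equivFin ι) (c • M),
    ← Matrix.charpoly_reindex (Fintype.equivFin ι) M]
  obtain ⟨P, Q, T, hQP, hM, hT⟩ :=
    exists_similar_isUpperTriangular (Matrix.reindex (Fintype.equivFin ι) (Fintype.equivFin ι) M)
  have h2 : Matrix.reindex (Fintype.equivFin ι) (Fintype.equivFin ι) (c • M) =
      P * ((c • T) * Q) := by
    rw [Matrix.smul_mul, Matrix.mul_smul, ← hM]
    rfl
  rw [h2, hM, Matrix.charpoly_mul_comm, mul_assoc, hQP, Matrix.charpoly_mul_comm P, mul_assoc, hQP,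
    mul_one, mul_one, roots_charpoly_of_triangular T id Function.injective_id fun i j h => hT h,
    roots_charpoly_of_triangular (c • T) id Function.injective_id fun i j h => by
      rw [Matrix.smul_apply, hT h, smul_zero], Multiset.map_map]
  rfl

/-! ### Perron–Frobenius: the Collatz–Wielandt bound and positivity -/

section PerronFrobenius

variable {ι : Type*}

/-- Irreducibility in terms of the support of a matrix: every proper nonempty set of indices has
an edge leaving it. -/
def HasExits (B : Matrix ι ι ℝ) : Prop :=
  ∀ S : Set ι, S.Nonempty → Sᶜ.Nonempty → ∃ i ∈ S, ∃ j ∈ Sᶜ, B i j ≠ 0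

variable [Fintype ι]

theorem hasExits_of_not_isReducible {B : Matrix ι ι ℝ} (h : ¬ IsReducible B) : HasExits B := by
  classical
  intro S hS hS'
  by_contra! hB
  let e := ((Fintype.equivFin S).symm.sumCongr (Fintype.equivFin (Sᶜ : Set ι)).symm).trans
    (Equiv.Set.sumCompl S)
  refine h ⟨_, _, e, (B.submatrix e e).toBlocks₁₁, (B.submatrix e e).toBlocks₂₁,
    (B.submatrix e e).toBlocks₂₂, Fintype.card_pos_iff.2 hS.to_subtype,
    Fintype.card_pos_iff.2 hS'.to_subtype, ?_⟩
  have h0 : (B.submatrix e e).toBlocks₁₂ = 0 := by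
    ext i j
    exact hB _ (Subtype.prop _) _ (Subtype.prop _)
  rw [← h0, Matrix.fromBlocks_toBlocks]

theorem mulVec_mono {B : Matrix ι ι ℝ} (hB : ∀ i j, 0 ≤ B i j) {v w : ι → ℝ} (h : ∀ i, v i ≤ w i)
    (i : ι) : (B *ᵥ v) i ≤ (B *ᵥ w) i :=
  Finset.sum_le_sum fun j _ => mul_le_mul_of_nonneg_left (h j) (hB i j)

theorem mulVec_nonneg {B : Matrix ι ι ℝ} (hB : ∀ i j, 0 ≤ B i j) {w : ι → ℝ} (h : ∀ i, 0 ≤ w i)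
    (i : ι) : 0 ≤ (B *ᵥ w) i :=
  Finset.sum_nonneg fun j _ => mul_nonneg (hB i j) (h j)

variable [DecidableEq ι]

theorem isRoot_charpoly_iff_exists_mulVec {K : Type*} [Field K] (M : Matrix ι ι K) (c : K) :
    M.charpoly.IsRoot c ↔ ∃ v, v ≠ 0 ∧ M *ᵥ v = c • v := by
  rw [Polynomial.IsRoot, Matrix.eval_charpoly, ← Matrix.exists_mulVec_eq_zero_iff]
  refine exists_congr fun v => and_congr_right fun _ => ?_
  rw [Matrix.sub_mulVec, sub_eq_zero, Matrix.scalar_apply, ← Matrix.smul_one_eq_diagonal,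
    Matrix.smul_mulVec, Matrix.one_mulVec, eq_comm]

/-- The complexification of a real matrix. -/
noncomputable abbrev complexify (B : Matrix ι ι ℝ) : Matrix ι ι ℂ := B.map (algebraMap ℝ ℂ)

theorem aroots_charpoly (B : Matrix ι ι ℝ) :
    B.charpoly.aroots ℂ = (complexify B).charpoly.roots := by
  rw [Polynomial.aroots_def, Matrix.charpoly_map]

theorem mem_aroots_charpoly_iff (B : Matrix ι ι ℝ) (z : ℂ) :
    z ∈ B.charpoly.aroots ℂ ↔ z ∈ spectrum ℂ (complexify B) := by
  rw [aroots_charpoly, Matrix.mem_spectrum_iff_isRoot_charpoly,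
    Polynomial.mem_roots (Matrix.charpoly_monic _).ne_zero]

/-- The spectral radius of a real matrix. -/
noncomputable def specRad (B : Matrix ι ι ℝ) : ℝ := (spectralRadius ℂ (complexify B)).toReal

theorem spectralRadius_complexify_ne_top [Nonempty ι] (B : Matrix ι ι ℝ) :
    spectralRadius ℂ (complexify B) ≠ ⊤ := by
  let _ : NormedRing (Matrix ι ι ℂ) := Matrix.linftyOpNormedRing
  let _ : NormedAlgebra ℂ (Matrix ι ι ℂ) := Matrix.linftyOpNormedAlgebra
  have : CompleteSpace (Matrix ι ι ℂ) := FiniteDimensional.complete ℂ _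
  exact ((spectrum.spectralRadius_le_nnnorm (𝕜 := ℂ) (complexify B)).trans_lt
    ENNReal.coe_lt_top).ne

theorem norm_le_specRad [Nonempty ι] (B : Matrix ι ι ℝ) {z : ℂ} (hz : z ∈ B.charpoly.aroots ℂ) :
    ‖z‖ ≤ specRad B := by
  rw [mem_aroots_charpoly_iff] at hz
  have h : (‖z‖₊ : ENNReal) ≤ spectralRadius ℂ (complexify B) :=
    le_iSup₂ (f := fun (k : ℂ) (_ : k ∈ spectrum ℂ (complexify B)) => (‖k‖₊ : ENNReal)) z hz
  simpa [specRad] using ENNReal.toReal_mono (spectralRadius_complexify_ne_top B) h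

theorem exists_norm_eq_specRad [Nonempty ι] (B : Matrix ι ι ℝ) :
    ∃ z ∈ B.charpoly.aroots ℂ, ‖z‖ = specRad B := by
  let _ : NormedRing (Matrix ι ι ℂ) := Matrix.linftyOpNormedRing
  let _ : NormedAlgebra ℂ (Matrix ι ι ℂ) := Matrix.linftyOpNormedAlgebra
  have : CompleteSpace (Matrix ι ι ℂ) := FiniteDimensional.complete ℂ _
  obtain ⟨z, hz, h⟩ := spectrum.exists_nnnorm_eq_spectralRadius (complexify B)
  refine ⟨z, (mem_aroots_charpoly_iff B z).2 hz, ?_⟩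
  rw [specRad, ← h]
  simp

theorem specRad_nonneg (B : Matrix ι ι ℝ) : 0 ≤ specRad B := ENNReal.toReal_nonneg

/-- Collatz–Wielandt bound: a nonnegative vector with `r w ≤ B w` forces `r ≤ ρ(B)`. -/
theorem le_specRad_of_smul_le {B : Matrix ι ι ℝ} (hB : ∀ i j, 0 ≤ B i j) {w : ι → ℝ}
    (hw : ∀ i, 0 ≤ w i) (hw0 : w ≠ 0) {r : ℝ} (hr : 0 ≤ r)
    (h : ∀ i, r * w i ≤ (B *ᵥ w) i) : r ≤ specRad B := by
  let _ : NormedRing (Matrix ι ι ℂ) := Matrix.linftyOpNormedRing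
  let _ : NormedAlgebra ℂ (Matrix ι ι ℂ) := Matrix.linftyOpNormedAlgebra
  have : CompleteSpace (Matrix ι ι ℂ) := FiniteDimensional.complete ℂ _
  obtain ⟨j, hj⟩ := Function.ne_iff.1 hw0
  have : Nonempty ι := ⟨j⟩
  obtain ⟨i, hi⟩ := Finite.exists_max w
  have hwi : 0 < w i := ((hw j).lt_of_ne (Ne.symm hj)).trans_le (hi j)
  -- Iterating the inequality gives r^k ≤ ‖B^k‖, read off at an index where w is maximal; Gelfand's
  -- formula then passes to the spectral radius.
  have hpow : ∀ k : ℕ, ∀ i, r ^ k * w i ≤ (B ^ k *ᵥ w) i := by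
    intro k
    induction k with
    | zero => simp
    | succ k ih =>
      intro i
      rw [pow_succ', pow_succ', ← Matrix.mulVec_mulVec]
      calc r * r ^ k * w i = r ^ k * (r * w i) := by ring
        _ ≤ r ^ k * (B *ᵥ w) i := mul_le_mul_of_nonneg_left (h i) (pow_nonneg hr k)
        _ = (B *ᵥ (r ^ k • w)) i := by rw [Matrix.mulVec_smul]; rfl
        _ ≤ _ := mulVec_mono hB (fun j => by simpa using ih j) i
  have hnorm : ∀ k : ℕ, r ^ k ≤ ‖complexify B ^ k‖ := by
    intro k
    have h1 : ‖complexify B ^ k *ᵥ (fun i => (w i : ℂ))‖ ≤ _ := Matrix.linfty_opNorm_mulVec _ _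
    have h2 : ‖fun i => (w i : ℂ)‖ ≤ w i := by
      rw [pi_norm_le_iff_of_nonneg hwi.le]
      intro j
      simpa [abs_of_nonneg (hw j)] using hi j
    have h3 : (complexify B ^ k *ᵥ (fun i => (w i : ℂ))) i = (((B ^ k *ᵥ w) i : ℝ) : ℂ) := by
      have : complexify B ^ k = (B ^ k).map (algebraMap ℝ ℂ) :=
        (map_pow (algebraMap ℝ ℂ).mapMatrix B k).symm
      rw [this]
      simp [Matrix.mulVec, dotProduct]
    have h4 := norm_le_pi_norm (complexify B ^ k *ᵥ (fun i => (w i : ℂ))) i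
    rw [h3, Complex.norm_real] at h4
    have h5 := (hpow k i).trans ((le_abs_self _).trans (h4.trans h1))
    have h6 := h5.trans (mul_le_mul_of_nonneg_left h2 (norm_nonneg _))
    exact le_of_mul_le_mul_right h6 hwi
  have hlim := spectrum.pow_norm_pow_one_div_tendsto_nhds_spectralRadius (complexify B)
  have hle : ENNReal.ofReal r ≤ spectralRadius ℂ (complexify B) := by
    refine ge_of_tendsto hlim ?_
    filter_upwards [Filter.eventually_ge_atTop 1] with k hk
    refine ENNReal.ofReal_le_ofReal ?_
    calc r = (r ^ k) ^ (1 / k : ℝ) := by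
          rw [one_div, Real.pow_rpow_inv_natCast hr (by omega)]
      _ ≤ _ := Real.rpow_le_rpow (pow_nonneg hr k) (hnorm k) (by positivity)
  have := ENNReal.toReal_mono (spectralRadius_complexify_ne_top B) hle
  rwa [ENNReal.toReal_ofReal hr] at this

/-- The identity summand keeps positive coordinates positive, while an edge leaving the zero set
makes at least one new coordinate positive. Induction on the number of zeros. -/
theorem exists_pow_mulVec_pos {B : Matrix ι ι ℝ} (hB : ∀ i j, 0 ≤ B i j) (hirr : HasExits B)
    (w : ι → ℝ) (hw : ∀ i, 0 ≤ w i) (hw0 : w ≠ 0) :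
    ∃ N : ℕ, ∀ i, 0 < ((1 + B) ^ N *ᵥ w) i := by
  induction hm : (Finset.univ.filter fun i => w i = 0).card using Nat.strong_induction_on
    generalizing w with
  | _ m ih =>
  by_cases hpos : ∀ i, 0 < w i
  · exact ⟨0, by simpa using hpos⟩
  push Not at hpos
  obtain ⟨i, hi⟩ := hpos
  obtain ⟨k, hk⟩ := Function.ne_iff.1 hw0
  obtain ⟨a, ha, b, hb, hab⟩ := hirr {i | w i = 0} ⟨i, le_antisymm hi (hw i)⟩ ⟨k, hk⟩
  have hval : ∀ i, ((1 + B) *ᵥ w) i = w i + (B *ᵥ w) i := fun i => by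
    rw [Matrix.add_mulVec, Matrix.one_mulVec, Pi.add_apply]
  have hge : ∀ i, w i ≤ ((1 + B) *ᵥ w) i := fun i => by
    rw [hval]
    exact le_add_of_nonneg_right (mulVec_nonneg hB hw i)
  have hpos : 0 < ((1 + B) *ᵥ w) a := by
    rw [hval, show w a = 0 from ha, zero_add]
    refine Finset.sum_pos' (fun j _ => mul_nonneg (hB a j) (hw j)) ⟨b, Finset.mem_univ _, ?_⟩
    exact mul_pos ((hB a b).lt_of_ne hab.symm) ((hw b).lt_of_ne (Ne.symm hb))
  obtain ⟨N, hN⟩ := ih _ (by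
    rw [← hm]
    refine Finset.card_lt_card (Finset.ssubset_iff_of_subset ?_ |>.2 ⟨a, ?_, ?_⟩)
    · intro i hi
      rw [Finset.mem_filter] at hi ⊢
      exact ⟨Finset.mem_univ _, le_antisymm (hi.2 ▸ hge i) (hw i)⟩
    · simpa using ha
    · simpa using hpos.ne') ((1 + B) *ᵥ w) (fun i => (hw i).trans (hge i)) (by
    intro h0
    rw [h0] at hpos
    exact lt_irrefl _ hpos) rfl
  exact ⟨N + 1, fun i => by rw [pow_succ, ← Matrix.mulVec_mulVec]; exact hN i⟩

/-- A nonnegative vector with `ρ w ≤ B w` is a positive eigenvector. -/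
theorem mulVec_eq_specRad_smul_of_le [Nonempty ι] {B : Matrix ι ι ℝ} (hB : ∀ i j, 0 ≤ B i j)
    (hirr : HasExits B) {w : ι → ℝ} (hw : ∀ i, 0 ≤ w i) (hw0 : w ≠ 0)
    (h : ∀ i, specRad B * w i ≤ (B *ᵥ w) i) :
    B *ᵥ w = specRad B • w ∧ ∀ i, 0 < w i := by
  have h1B : ∀ i j, 0 ≤ (1 + B) i j := fun i j => by
    rw [Matrix.add_apply, Matrix.one_apply]
    have := hB i j
    split_ifs <;> linarith
  have heq : B *ᵥ w = specRad B • w := by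
    by_contra hne
    -- The defect Bw - ρw is nonnegative and nonzero, so a power of 1 + B makes it positive. That
    -- power commutes with B, so u = (1 + B)^N w satisfies ρu < Bu in every coordinate.
    obtain ⟨N, hN⟩ := exists_pow_mulVec_pos hB hirr (B *ᵥ w - specRad B • w)
      (fun i => by simpa using h i) (sub_ne_zero.2 hne)
    set u := (1 + B) ^ N *ᵥ w with hu
    have hcomm : (1 + B) ^ N * B = B * (1 + B) ^ N :=
      (((Commute.one_left B).add_left (Commute.refl B)).pow_left N).eq
    have hd : ∀ i, 0 < (B *ᵥ u) i - specRad B * u i := by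
      intro i
      have := hN i
      rwa [Matrix.mulVec_sub, Matrix.mulVec_smul, Matrix.mulVec_mulVec, hcomm,
        ← Matrix.mulVec_mulVec] at this
    have hu0 : ∀ i, 0 ≤ u i := by
      have : ∀ N : ℕ, ∀ i, 0 ≤ ((1 + B) ^ N *ᵥ w) i := by
        intro N
        induction N with
        | zero => simpa using hw
        | succ N ih =>
          intro i
          rw [pow_succ', ← Matrix.mulVec_mulVec]
          exact mulVec_nonneg h1B ih i
      exact this N
    have hune : u ≠ 0 := by
      intro h0
      have := hd (Classical.arbitrary ι)
      simp [h0] at this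
    obtain ⟨m, hm⟩ := Finite.exists_max u
    obtain ⟨l, hl⟩ := Finite.exists_min fun i => (B *ᵥ u) i - specRad B * u i
    have hum : 0 < u m := by
      obtain ⟨j, hj⟩ := Function.ne_iff.1 hune
      exact ((hu0 j).lt_of_ne (Ne.symm hj)).trans_le (hm j)
    -- The smallest slack over the largest entry of u: then (ρ + ε)u ≤ Bu, against the
    -- Collatz–Wielandt bound.
    set ε := ((B *ᵥ u) l - specRad B * u l) / u m with hε
    have hεpos : 0 < ε := div_pos (hd l) hum
    have := le_specRad_of_smul_le hB hu0 hune (r := specRad B + ε)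
      (add_nonneg (specRad_nonneg B) hεpos.le) (fun i => by
        have h1 : ε * u i ≤ ε * u m := mul_le_mul_of_nonneg_left (hm i) hεpos.le
        have h2 : ε * u m = (B *ᵥ u) l - specRad B * u l := div_mul_cancel₀ _ hum.ne'
        have h3 := hl i
        linarith)
    linarith
  refine ⟨heq, ?_⟩
  obtain ⟨N, hN⟩ := exists_pow_mulVec_pos hB hirr w hw hw0
  have hpow : ∀ N : ℕ, (1 + B) ^ N *ᵥ w = (1 + specRad B) ^ N • w := by
    intro N
    induction N with
    | zero => simp
    | succ N ih =>
      rw [pow_succ, ← Matrix.mulVec_mulVec, Matrix.add_mulVec, Matrix.one_mulVec, heq,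
        Matrix.mulVec_add, Matrix.mulVec_smul, ih, pow_succ]
      module
  intro i
  have := hN i
  rw [hpow, Pi.smul_apply, smul_eq_mul] at this
  exact pos_of_mul_pos_right this (pow_nonneg (by linarith [specRad_nonneg B]) N)

end PerronFrobenius

/-! ### Perron–Frobenius: the peripheral spectrum -/

section PerronFrobeniusSpectrum

variable {ι : Type*} [Fintype ι] [DecidableEq ι] {B : Matrix ι ι ℝ}

theorem mem_aroots_charpoly_iff_exists_mulVec (B : Matrix ι ι ℝ) (c : ℂ) :
    c ∈ B.charpoly.aroots ℂ ↔ ∃ v, v ≠ 0 ∧ complexify B *ᵥ v = c • v := by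
  rw [aroots_charpoly, Polynomial.mem_roots (Matrix.charpoly_monic _).ne_zero,
    isRoot_charpoly_iff_exists_mulVec]

variable [Nonempty ι]

/-- The moduli of the entries of a peripheral eigenvector form a positive eigenvector. -/
theorem mulVec_norm_eq (hB : ∀ i j, 0 ≤ B i j) (hirr : HasExits B) {c : ℂ} (hc : ‖c‖ = specRad B)
    {z : ι → ℂ} (hz : z ≠ 0) (h : complexify B *ᵥ z = c • z) :
    (B *ᵥ fun i => ‖z i‖) = specRad B • (fun i => ‖z i‖) ∧ ∀ i, 0 < ‖z i‖ := by
  refine mulVec_eq_specRad_smul_of_le hB hirr (fun i => norm_nonneg _) ?_ fun i => ?_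
  · intro h0
    exact hz (funext fun i => by simpa using congrFun h0 i)
  · calc specRad B * ‖z i‖ = ‖(complexify B *ᵥ z) i‖ := by rw [h]; simp [hc]
      _ ≤ ∑ j, ‖complexify B i j * z j‖ := norm_sum_le _ _
      _ = (B *ᵥ fun i => ‖z i‖) i := by
        refine Finset.sum_congr rfl fun j _ => ?_
        simp [abs_of_nonneg (hB i j)]

theorem exists_pos_eigenvector (hB : ∀ i j, 0 ≤ B i j) (hirr : HasExits B) :
    ∃ x : ι → ℝ, (∀ i, 0 < x i) ∧ B *ᵥ x = specRad B • x := by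
  obtain ⟨c, hc, hcn⟩ := exists_norm_eq_specRad B
  obtain ⟨z, hz, h⟩ := (mem_aroots_charpoly_iff_exists_mulVec B c).1 hc
  have := mulVec_norm_eq hB hirr hcn hz h
  exact ⟨_, this.2, this.1⟩

theorem specRad_pos [Nontrivial ι] (hB : ∀ i j, 0 ≤ B i j) (hirr : HasExits B) :
    0 < specRad B := by
  obtain ⟨x, hx, h⟩ := exists_pos_eigenvector hB hirr
  refine (specRad_nonneg B).lt_of_ne fun h0 => ?_
  obtain ⟨i, j, hij⟩ := exists_pair_ne ι
  obtain ⟨a, -, b, -, hab⟩ := hirr {i} ⟨i, rfl⟩ ⟨j, hij.symm⟩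
  have h1 : (B *ᵥ x) a = 0 := by rw [h, ← h0, zero_smul, Pi.zero_apply]
  have h2 := (Finset.sum_eq_zero_iff_of_nonneg
    fun j _ => mul_nonneg (hB a j) (hx j).le).1 h1 b (Finset.mem_univ _)
  exact (mul_ne_zero hab (hx b).ne') h2

/-- The eigenspace of the spectral radius is spanned by a positive eigenvector. -/
theorem eq_smul_of_mulVec_eq (hB : ∀ i j, 0 ≤ B i j) (hirr : HasExits B) {x y : ι → ℝ}
    (hx : ∀ i, 0 < x i) (hBx : B *ᵥ x = specRad B • x) (hBy : B *ᵥ y = specRad B • y) :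
    ∃ c : ℝ, y = c • x := by
  -- For the minimal ratio, y - (y m / x m) x is nonnegative and vanishes at m. If it were nonzero,
  -- it would be a positive eigenvector.
  obtain ⟨m, hm⟩ := Finite.exists_min fun i => y i / x i
  refine ⟨y m / x m, ?_⟩
  by_contra hne
  have h := (mulVec_eq_specRad_smul_of_le hB hirr (w := y - (y m / x m) • x) (fun i => by
    have := (le_div_iff₀ (hx i)).1 (hm i)
    simpa using this) (sub_ne_zero.2 hne) (fun i => le_of_eq (by
      rw [Matrix.mulVec_sub, Matrix.mulVec_smul, hBx, hBy]
      simp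
      ring))).2 m
  simp [(hx m).ne'] at h

/-- This excludes a Jordan block at ρ. If c > 0, adding a large multiple of x to y gives w > 0 with
Bw = ρw + cx ≥ ρw; such a w must be an eigenvector, which is absurd. The case c < 0 follows by
negation. -/
theorem eq_zero_of_mulVec_sub_eq (hB : ∀ i j, 0 ≤ B i j) (hirr : HasExits B) {x y : ι → ℝ}
    (hx : ∀ i, 0 < x i) (hBx : B *ᵥ x = specRad B • x) {c : ℝ}
    (hBy : B *ᵥ y = specRad B • y + c • x) : c = 0 := by
  have key : ∀ (c : ℝ) (y : ι → ℝ), 0 < c → B *ᵥ y = specRad B • y + c • x → False := by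
    intro c y hc hBy
    obtain ⟨m, hm⟩ := Finite.exists_min fun i => y i / x i
    set t := 1 - y m / x m with ht
    have hw : ∀ i, 0 < (y + t • x) i := by
      intro i
      have h1 := (le_div_iff₀ (hx i)).1 (hm i)
      have h2 := hx i
      simp only [Pi.add_apply, Pi.smul_apply, smul_eq_mul, ht, sub_mul, one_mul]
      linarith
    have hBw : B *ᵥ (y + t • x) = specRad B • (y + t • x) + c • x := by
      rw [Matrix.mulVec_add, Matrix.mulVec_smul, hBx, hBy]
      module
    have h := (mulVec_eq_specRad_smul_of_le hB hirr (fun i => (hw i).le) (fun h0 => by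
      have := hw m
      rw [h0] at this
      exact lt_irrefl _ this) (fun i => by
        rw [hBw]
        have := mul_pos hc (hx i)
        simp only [Pi.add_apply, Pi.smul_apply, smul_eq_mul]
        linarith)).1
    rw [hBw] at h
    have := congrFun (add_eq_left.1 h) m
    exact (mul_pos hc (hx m)).ne' (by simpa using this)
  rcases lt_trichotomy c 0 with h | h | h
  · exact (key (-c) (-y) (by linarith) (by rw [Matrix.mulVec_neg, hBy]; module)).elim
  · exact h
  · exact (key c y h hBy).elim

/-- The algebraic multiplicity is the dimension of the maximal generalized eigenspace. Since B and ρ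
are real, real and imaginary parts reduce it to the real statements above, and the eigenspace is
already the whole generalized one. -/
theorem count_specRad (hB : ∀ i j, 0 ≤ B i j) (hirr : HasExits B) :
    (B.charpoly.aroots ℂ).count (specRad B : ℂ) = 1 := by
  obtain ⟨x, hx, hBx⟩ := exists_pos_eigenvector hB hirr
  rw [aroots_charpoly, Polynomial.count_roots, ← Matrix.charpoly_toLin',
    ← LinearMap.finrank_maxGenEigenspace_eq]
  set f : Module.End ℂ (ι → ℂ) := Matrix.toLin' (complexify B) with hf
  set ρ := specRad B with hρ
  set X : ι → ℂ := fun i => (x i : ℂ) with hX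
  have hreal : ∀ (g : ℂ →ₗ[ℝ] ℝ) (v : ι → ℂ),
      (fun i => g ((complexify B *ᵥ v) i)) = B *ᵥ fun i => g (v i) := by
    intro g v
    funext i
    simp only [Matrix.mulVec, dotProduct, map_sum, Matrix.map_apply]
    refine Finset.sum_congr rfl fun j _ => ?_
    have : (algebraMap ℝ ℂ) (B i j) * v j = (B i j) • v j := by simp
    rw [this, map_smul, smul_eq_mul]
  have hsplit : ∀ (g : ℂ →ₗ[ℝ] ℝ) (c : ℂ) (v : ι → ℂ),
      complexify B *ᵥ v = (ρ : ℂ) • v + c • X →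
      B *ᵥ (fun i => g (v i)) = ρ • (fun i => g (v i)) + g c • x := by
    intro g c v h
    rw [← hreal, h]
    funext i
    have h1 : (ρ : ℂ) * v i + c * (x i : ℂ) = ρ • v i + x i • c := by
      simp [mul_comm]
    simp only [Pi.add_apply, Pi.smul_apply, smul_eq_mul, hX, h1, map_add, map_smul]
    ring
  have hker : ∀ (v : ι → ℂ) (c : ℂ), complexify B *ᵥ v = (ρ : ℂ) • v + c • X → ∃ d : ℂ, v = d • X := by
    intro v c h
    have hre := hsplit Complex.reLm c v h
    have him := hsplit Complex.imLm c v h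
    rw [eq_zero_of_mulVec_sub_eq hB hirr hx hBx hre, zero_smul, add_zero] at hre
    rw [eq_zero_of_mulVec_sub_eq hB hirr hx hBx him, zero_smul, add_zero] at him
    obtain ⟨a, ha⟩ := eq_smul_of_mulVec_eq hB hirr hx hBx hre
    obtain ⟨b, hb⟩ := eq_smul_of_mulVec_eq hB hirr hx hBx him
    refine ⟨⟨a, b⟩, funext fun i => Complex.ext ?_ ?_⟩
    · simpa [hX] using congrFun ha i
    · simpa [hX] using congrFun hb i
  have hpow : ∀ (k : ℕ) (v : ι → ℂ), ((f - (ρ : ℂ) • (1 : Module.End ℂ (ι → ℂ))) ^ k) v = 0 →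
      ∃ d : ℂ, v = d • X := by
    intro k
    induction k with
    | zero =>
      intro v hv
      exact ⟨0, by simpa using hv⟩
    | succ k ih =>
      intro v hv
      rw [pow_succ, Module.End.mul_apply] at hv
      obtain ⟨c, hc⟩ := ih _ hv
      refine hker v c ?_
      rw [← hc]
      simp [hf]
  have hX0 : X ≠ 0 := fun h0 => by
    have i := Classical.arbitrary ι
    have := congrFun h0 i
    simp [hX, (hx i).ne'] at this
  have hspan : f.maxGenEigenspace (ρ : ℂ) = Submodule.span ℂ {X} := by
    refine le_antisymm (fun v hv => ?_) ?_
    · obtain ⟨k, hk⟩ := Module.End.mem_maxGenEigenspace _ _ _ |>.1 hv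
      obtain ⟨d, rfl⟩ := hpow k v hk
      exact Submodule.smul_mem _ _ (Submodule.mem_span_singleton_self X)
    · rw [Submodule.span_singleton_le_iff_mem, Module.End.mem_maxGenEigenspace]
      refine ⟨1, ?_⟩
      have : complexify B *ᵥ X = (ρ : ℂ) • X := by
        funext i
        have := congrFun hBx i
        simp only [Matrix.mulVec, dotProduct, Pi.smul_apply, smul_eq_mul] at this
        simp only [Matrix.mulVec, dotProduct, Pi.smul_apply, smul_eq_mul, hX, Matrix.map_apply]
        rw [← Complex.ofReal_mul, ← this]
        simp
      simp [hf, this]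
  rw [hspan, finrank_span_singleton hX0]

/-- Peripheral eigenvalues of an irreducible nonnegative matrix rotate the spectrum. -/
theorem map_mul_aroots_charpoly (hB : ∀ i j, 0 ≤ B i j) (hirr : HasExits B)
    (hpos : 0 < specRad B) {c : ℂ} (hc : c ∈ B.charpoly.aroots ℂ) (hcn : ‖c‖ = specRad B) :
    (B.charpoly.aroots ℂ).map ((c / specRad B) * ·) = B.charpoly.aroots ℂ := by
  obtain ⟨z, hz, h⟩ := (mem_aroots_charpoly_iff_exists_mulVec B c).1 hc
  obtain ⟨hw, hzpos⟩ := mulVec_norm_eq hB hirr hcn hz h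
  have hρ : (specRad B : ℂ) ≠ 0 := by exact_mod_cast hpos.ne'
  set ω : ℂ := c / specRad B with hω
  have hωn : ‖ω‖ = 1 := by
    rw [hω, norm_div, hcn, Complex.norm_real, Real.norm_of_nonneg hpos.le, div_self hpos.ne']
  set u : ι → ℂ := fun i => z i / ‖z i‖ with hu
  have hzn : ∀ i, (‖z i‖ : ℂ) ≠ 0 := fun i => by exact_mod_cast (hzpos i).ne'
  have hzu : ∀ i, z i = ‖z i‖ * u i := fun i => (mul_div_cancel₀ _ (hzn i)).symm
  have hun : ∀ i, ‖u i‖ = 1 := by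
    intro i
    simp [hu, (norm_pos_iff.1 (hzpos i))]
  have hu0 : ∀ i, u i ≠ 0 := fun i h0 => by simpa [h0] using hun i
  have hω0 : ω ≠ 0 := fun h0 => by simp [h0] at hωn
  -- Equality in the triangle inequality: the phases u j / (ω u i), weighted by B i j ‖z j‖, average
  -- to 1, so each phase of nonzero weight equals 1. Hence B is similar to ωB through the diagonal
  -- matrix of the u i.
  have hcomm : ∀ i j, (B i j : ℂ) * u j = ω * u i * B i j := by
    intro i
    have hsum : ∑ j, B i j * ‖z j‖ * (1 - (u j / (ω * u i)).re) = 0 := by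
      have h1 : ∑ j, (B i j : ℂ) * ‖z j‖ * (u j / (ω * u i)) = specRad B * ‖z i‖ := by
        have h2 : ∑ j, (B i j : ℂ) * z j = c * z i := by
          simpa [Matrix.mulVec, dotProduct] using congrFun h i
        calc ∑ j, (B i j : ℂ) * ‖z j‖ * (u j / (ω * u i))
            = (∑ j, (B i j : ℂ) * z j) / (ω * u i) := by
              rw [Finset.sum_div]
              refine Finset.sum_congr rfl fun j _ => ?_
              conv_rhs => rw [hzu j]
              ring
          _ = specRad B * ‖z i‖ := by
              rw [h2, div_eq_iff (mul_ne_zero hω0 (hu0 i))]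
              conv_lhs => rw [hzu i]
              rw [hω]
              field_simp
      have h3 : ∑ j, B i j * ‖z j‖ = specRad B * ‖z i‖ := by
        simpa [Matrix.mulVec, dotProduct] using congrFun hw i
      have h4 := congrArg Complex.re h1
      rw [Complex.re_sum] at h4
      simp only [mul_sub, mul_one, Finset.sum_sub_distrib, h3]
      rw [sub_eq_zero]
      have h5 : ((specRad B : ℂ) * ‖z i‖).re = specRad B * ‖z i‖ := by
        rw [← Complex.ofReal_mul, Complex.ofReal_re]
      rw [← h5, ← h4]
      refine Finset.sum_congr rfl fun j _ => ?_
      rw [← Complex.ofReal_mul, Complex.re_ofReal_mul]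
    have hqn : ∀ j, ‖u j / (ω * u i)‖ = 1 := fun j => by simp [hun, hωn]
    have hnn : ∀ j ∈ Finset.univ, 0 ≤ B i j * ‖z j‖ * (1 - (u j / (ω * u i)).re) := fun j _ =>
      mul_nonneg (mul_nonneg (hB i j) (norm_nonneg _))
        (sub_nonneg.2 ((Complex.re_le_norm _).trans (hqn j).le))
    intro j
    have h0 := (Finset.sum_eq_zero_iff_of_nonneg hnn).1 hsum j (Finset.mem_univ _)
    rcases mul_eq_zero.1 h0 with h0 | h0
    · have : B i j = 0 := (mul_eq_zero.1 h0).resolve_right (hzpos j).ne'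
      simp [this]
    · have hre : (u j / (ω * u i)).re = 1 := by linarith
      have him : (u j / (ω * u i)).im = 0 := by
        have := Complex.sq_norm (u j / (ω * u i))
        rw [hqn, Complex.normSq_apply, hre] at this
        nlinarith
      have : u j / (ω * u i) = 1 := Complex.ext (by simpa using hre) (by simpa using him)
      rw [div_eq_one_iff_eq (mul_ne_zero hω0 (hu0 i))] at this
      rw [this, mul_comm]
  have hsim : complexify B = Matrix.diagonal u * ((ω • complexify B) *
      Matrix.diagonal (fun i => (u i)⁻¹)) := by
    ext i j
    rw [Matrix.diagonal_mul, Matrix.mul_diagonal, Matrix.smul_apply]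
    have := hcomm i j
    simp only [Matrix.map_apply, Complex.coe_algebraMap, smul_eq_mul]
    rw [eq_comm, ← mul_assoc, ← div_eq_mul_inv, div_eq_iff (hu0 j), this]
    ring
  have hdiag : Matrix.diagonal (fun i => (u i)⁻¹) * Matrix.diagonal u = 1 := by
    rw [Matrix.diagonal_mul_diagonal, ← Matrix.diagonal_one]
    congr 1
    funext i
    exact inv_mul_cancel₀ (hu0 i)
  rw [aroots_charpoly, ← roots_charpoly_smul]
  conv_rhs => rw [hsim, Matrix.charpoly_mul_comm, mul_assoc, hdiag, mul_one]

/-- Peripheral eigenvalues of an irreducible nonnegative matrix are simple. -/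
theorem count_eq_one_of_norm_eq_specRad (hB : ∀ i j, 0 ≤ B i j) (hirr : HasExits B)
    (hpos : 0 < specRad B) {c : ℂ} (hc : c ∈ B.charpoly.aroots ℂ) (hcn : ‖c‖ = specRad B) :
    (B.charpoly.aroots ℂ).count c = 1 := by
  have hρ : (specRad B : ℂ) ≠ 0 := by exact_mod_cast hpos.ne'
  have hc0 : c ≠ 0 := fun h0 => by simp [h0] at hcn; exact hpos.ne hcn
  have h := map_mul_aroots_charpoly hB hirr hpos hc hcn
  rw [← count_specRad hB hirr]
  conv_lhs => rw [← h]
  have h2 := Multiset.count_map_eq_count' ((c / specRad B) * ·) (B.charpoly.aroots ℂ)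
    (mul_right_injective₀ (div_ne_zero hc0 hρ)) (specRad B : ℂ)
  simpa only [div_mul_cancel₀ _ hρ] using h2

end PerronFrobeniusSpectrum

/-! ### The second compound: multiplicativity and eigenvalues -/

section Minors

variable {n : ℕ} {R : Type*} [CommRing R]

theorem sum_pairs (F : Fin n → Fin n → R) (hF : ∀ k, F k k = 0) :
    ∑ p : Pairs n, (F p.1.1 p.1.2 + F p.1.2 p.1.1) = ∑ k, ∑ l, F k l := by
  have hsub : ∀ G : Fin n × Fin n → R,
      ∑ p : Pairs n, G p.1 = ∑ x : Fin n × Fin n, if x.1 < x.2 then G x else 0 := by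
    intro G
    rw [← Finset.sum_filter]
    exact (Finset.sum_subtype _ (by simp) G).symm
  rw [Finset.sum_add_distrib, hsub fun x => F x.1 x.2, hsub fun x => F x.2 x.1,
    ← Equiv.sum_comp (Equiv.prodComm _ _) fun x : Fin n × Fin n => if x.1 < x.2 then F x.2 x.1 else 0,
    ← Finset.sum_add_distrib, ← Fintype.sum_prod_type']
  refine Finset.sum_congr rfl fun x _ => ?_
  rcases lt_trichotomy x.1 x.2 with h | h | h
  · simp [h, h.not_gt]
  · simp [h, hF]
  · simp [h, h.not_gt]

/-- The coordinates of `a ∧ b`. -/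
def wedge (a b : Fin n → R) (p : Pairs n) : R := a p.1.1 * b p.1.2 - a p.1.2 * b p.1.1

/-- The Binet–Cauchy identity. -/
theorem wedge_dotProduct_wedge (a b c d : Fin n → R) :
    wedge a b ⬝ᵥ wedge c d = (a ⬝ᵥ c) * (b ⬝ᵥ d) - (a ⬝ᵥ d) * (b ⬝ᵥ c) := by
  have h := sum_pairs (fun k l => a k * b l * (c k * d l - d k * c l)) (fun k => by ring)
  calc wedge a b ⬝ᵥ wedge c d = ∑ k, ∑ l, a k * b l * (c k * d l - d k * c l) := by
        rw [← h]
        refine Finset.sum_congr rfl fun p _ => ?_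
        simp only [wedge]
        ring
    _ = _ := by
        simp only [dotProduct, Finset.sum_mul_sum, ← Finset.sum_sub_distrib]
        refine Finset.sum_congr rfl fun k _ => Finset.sum_congr rfl fun l _ => ?_
        ring

/-- The matrix of `2 × 2` minors over a commutative ring. -/
def minors (A : Matrix (Fin n) (Fin n) R) : Matrix (Pairs n) (Pairs n) R :=
  Matrix.of fun p => wedge (A p.1.1) (A p.1.2)

theorem minors_apply (A : Matrix (Fin n) (Fin n) R) (p q : Pairs n) :
    minors A p q = A p.1.1 q.1.1 * A p.1.2 q.1.2 - A p.1.1 q.1.2 * A p.1.2 q.1.1 := rfl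

theorem compound_eq_minors (A : Matrix (Fin n) (Fin n) ℝ) : compound A = minors A := by
  ext p q
  rw [compound, Matrix.det_fin_two]
  rfl

theorem minors_mulVec_wedge (A : Matrix (Fin n) (Fin n) R) (x y : Fin n → R) :
    minors A *ᵥ wedge x y = wedge (A *ᵥ x) (A *ᵥ y) := by
  funext p
  simp only [Matrix.mulVec, minors, Matrix.of_apply, wedge_dotProduct_wedge]
  simp only [wedge, Matrix.mulVec]
  ring

theorem minors_mul (A B : Matrix (Fin n) (Fin n) R) : minors (A * B) = minors A * minors B := by
  ext p q
  have h : (fun r => minors B r q) = wedge (fun k => B k q.1.1) (fun k => B k q.1.2) := by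
    funext r
    simp only [minors_apply, wedge]
    ring
  rw [Matrix.mul_apply', show minors A p = wedge (A p.1.1) (A p.1.2) from rfl, h,
    wedge_dotProduct_wedge, minors_apply]
  rfl

theorem minors_one : minors (1 : Matrix (Fin n) (Fin n) R) = 1 := by
  ext ⟨⟨i, j⟩, hij⟩ ⟨⟨k, l⟩, hkl⟩
  simp only at hij hkl
  simp only [minors_apply, Matrix.one_apply, Subtype.mk.injEq, Prod.mk.injEq]
  have h : ¬ (i = l ∧ j = k) := by
    rintro ⟨rfl, rfl⟩
    exact lt_asymm hij hkl
  split_ifs <;> simp_all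

theorem minors_map {S : Type*} [CommRing S] (f : R →+* S) (A : Matrix (Fin n) (Fin n) R) :
    (minors A).map f = minors (A.map f) := by
  ext p q
  simp [minors_apply]

/-- Taking minors is multiplicative, so it carries a triangularization T of A to a similarity of the
compound with `minors T`. The latter is upper triangular for the lexicographic order of pairs, with
diagonal entries T i i * T j j. -/
theorem exists_aroots_charpoly_eq (A : Matrix (Fin n) (Fin n) ℝ) :
    ∃ t : Fin n → ℂ, A.charpoly.aroots ℂ = Finset.univ.val.map t ∧
      (compound A).charpoly.aroots ℂ =
        Finset.univ.val.map fun p : Pairs n => t p.1.1 * t p.1.2 := by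
  obtain ⟨P, Q, T, hQP, hM, hT⟩ := exists_similar_isUpperTriangular (complexify A)
  have hT : ∀ i j, j < i → T i j = 0 := fun i j h => hT h
  refine ⟨fun i => T i i, ?_, ?_⟩
  · rw [aroots_charpoly, hM, Matrix.charpoly_mul_comm, mul_assoc, hQP, mul_one,
      roots_charpoly_of_triangular T id Function.injective_id hT]
  · have hQP' : minors Q * minors P = 1 := by rw [← minors_mul, hQP, minors_one]
    rw [aroots_charpoly, compound_eq_minors, complexify, minors_map,
      show A.map (algebraMap ℝ ℂ) = _ from hM, minors_mul, minors_mul,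
      Matrix.charpoly_mul_comm, mul_assoc, hQP', mul_one,
      roots_charpoly_of_triangular (minors T) (fun p : Pairs n => toLex p.1)
        (fun p q h => Subtype.ext h)]
    · refine Multiset.map_congr rfl fun p _ => ?_
      rw [minors_apply, hT p.1.2 p.1.1 p.2, mul_zero, sub_zero]
    · intro p q h
      rw [minors_apply]
      rcases Prod.Lex.toLex_lt_toLex.1 h with h | ⟨h1, h2⟩
      · rw [hT _ _ h, hT _ _ (h.trans p.2)]
        simp
      · rw [hT _ _ h2, hT p.1.2 q.1.1 (h1 ▸ p.2)]
        simp

end Minors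

/-! ### From operators to matrices -/

section Operators

/-- Pairs `i < j` are the strictly increasing maps from a two-element chain. -/
def pairsEquiv (n : ℕ) : Pairs n ≃ (Fin 2 ↪o Fin n) where
  toFun p := OrderEmbedding.ofStrictMono ![p.1.1, p.1.2] (by
    rw [Fin.strictMono_iff_lt_succ]
    simpa using p.2)
  invFun f := ⟨(f 0, f 1), f.strictMono (by decide)⟩
  left_inv p := rfl
  right_inv f := by
    ext i
    fin_cases i <;> rfl

/-- In the basis of the e_i ∧ e_j with i < j, the matrix of A ∧ A is the compound. -/
theorem charpoly_exteriorSquare {n : ℕ} (A : Matrix (Fin n) (Fin n) ℝ) :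
    (exteriorSquare (Matrix.toLin' A)).charpoly = (compound A).charpoly := by
  let b := ((Pi.basisFun ℝ (Fin n)).exteriorPower 2).reindex
    ((pairsEquiv n).trans Set.powersetCard.ofFinEmbEquiv).symm
  rw [← LinearMap.charpoly_toMatrix _ b]
  congr 1
  ext p q
  rw [LinearMap.toMatrix_apply, Module.Basis.reindex_apply, exteriorPower.basis_apply,
    exteriorSquare, exteriorPower.map_apply_ιMulti_family, Module.Basis.repr_reindex_apply,
    exteriorPower.basis_repr_apply, exteriorPower.ιMulti_family,
    exteriorPower.ιMultiDual_apply_ιMulti, compound, ← Matrix.det_transpose]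
  congr 1
  ext i j
  fin_cases i <;> fin_cases j <;> simp <;> rfl

theorem eigs_eq_aroots {V : Type*} [AddCommGroup V] [Module ℝ V] [Module.Finite ℝ V]
    {ι : Type*} [Fintype ι] [DecidableEq ι] {f : V →ₗ[ℝ] V} {M : Matrix ι ι ℝ}
    (h : f.charpoly = M.charpoly) : eigs f = M.charpoly.aroots ℂ := by
  rw [eigs, h]

theorem rho_eq_specRad {V : Type*} [AddCommGroup V] [Module ℝ V] [Module.Finite ℝ V]
    {ι : Type*} [Fintype ι] [DecidableEq ι] {f : V →ₗ[ℝ] V} {M : Matrix ι ι ℝ}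
    (h : f.charpoly = M.charpoly) : rho f = specRad M := by
  have hs : spectrum ℂ (f.baseChange ℂ : Module.End ℂ (ℂ ⊗[ℝ] V)) =
      spectrum ℂ (complexify M) := by
    ext z
    rw [Module.End.mem_spectrum_iff_isRoot_charpoly, Matrix.mem_spectrum_iff_isRoot_charpoly,
      LinearMap.charpoly_baseChange, Matrix.charpoly_map, h]
  rw [rho, specRad, spectralRadius, spectralRadius, hs]

end Operators

/-! ### Linear orders and the set W -/

section Order

variable {n : ℕ} {J : Set (Pairs n)}

/-- The two hypotheses make W the order by values of g, and they force g to be injective, whence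
antisymmetry. -/
theorem isLinearOrderRel_of_ranking (g : Fin n → ℝ) (h1 : ∀ p ∈ J, g p.1.1 < g p.1.2)
    (h2 : ∀ p ∉ J, g p.1.2 < g p.1.1) : IsLinearOrderRel (wSet J) := by
  have hmem : ∀ i j, (i, j) ∈ wSet J ↔ g i ≤ g j := by
    intro i j
    simp only [wSet, Set.mem_ofPred_eq]
    constructor
    · rintro (h | ⟨h, hJ⟩ | ⟨h, hJ⟩)
      · rw [h]
      · exact (h1 _ hJ).le
      · exact (h2 _ hJ).le
    · intro hg
      rcases lt_trichotomy i j with h | h | h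
      · refine Or.inr (Or.inl ⟨h, ?_⟩)
        by_contra hJ
        exact (h2 _ hJ).not_ge hg
      · exact Or.inl h
      · refine Or.inr (Or.inr ⟨h, fun hJ => ?_⟩)
        exact (h1 _ hJ).not_ge hg
  refine ⟨fun i => (hmem i i).2 le_rfl, fun i j hij hji => ?_, fun i j k hij hjk => ?_,
    fun i j => ?_⟩
  · have heq := le_antisymm ((hmem i j).1 hij) ((hmem j i).1 hji)
    rcases lt_trichotomy i j with h | h | h
    · by_cases hJ : (⟨(i, j), h⟩ : Pairs n) ∈ J
      · exact absurd heq (h1 _ hJ).ne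
      · exact absurd heq (h2 _ hJ).ne'
    · exact h
    · by_cases hJ : (⟨(j, i), h⟩ : Pairs n) ∈ J
      · exact absurd heq (h1 _ hJ).ne'
      · exact absurd heq (h2 _ hJ).ne
  · exact (hmem i k).2 (((hmem i j).1 hij).trans ((hmem j k).1 hjk))
  · rw [hmem, hmem]
    exact le_total _ _

/-- With at most one pair, J is everything or empty, so W is the natural order or its reverse. Two
pairs are needed for the compound to have positive spectral radius: a 1 × 1 zero matrix is
irreducible. -/
theorem nontrivial_pairs_of_not_isLinearOrderRel (hW : ¬ IsLinearOrderRel (wSet J)) :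
    Nontrivial (Pairs n) := by
  by_contra h
  have := not_nontrivial_iff_subsingleton.1 h
  by_cases hJ : ∀ p, p ∈ J
  · exact hW (isLinearOrderRel_of_ranking (fun i => (i : ℝ)) (fun p _ => by simpa using p.2)
      fun p hp => absurd (hJ p) hp)
  · push Not at hJ
    obtain ⟨q, hq⟩ := hJ
    exact hW (isLinearOrderRel_of_ranking (fun i => -(i : ℝ))
      (fun p hp => absurd (Subsingleton.elim p q ▸ hp) hq) fun p _ => by simpa using p.2)

end Order

/-! ### Sign symmetry as diagonal conjugation -/

section SignSymmetric

variable {ι : Type*}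

open Classical in
/-- The signs attached to a set of indices. -/
noncomputable def sgn (J : Set ι) (i : ι) : ℝ := if i ∈ J then 1 else -1

theorem sgn_mul_self (J : Set ι) (i : ι) : sgn J i * sgn J i = 1 := by
  unfold sgn
  split_ifs <;> norm_num

theorem sgn_ne_zero (J : Set ι) (i : ι) : sgn J i ≠ 0 := fun h => by
  simpa [h] using sgn_mul_self J i

variable [Fintype ι] [DecidableEq ι]

/-- The conjugate of a matrix by the diagonal matrix of signs of `J`. -/
noncomputable def signed (J : Set ι) (C : Matrix ι ι ℝ) : Matrix ι ι ℝ :=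
  Matrix.diagonal (sgn J) * (C * Matrix.diagonal (sgn J))

theorem signed_apply (J : Set ι) (C : Matrix ι ι ℝ) (i j : ι) :
    signed J C i j = sgn J i * (C i j * sgn J j) := by
  rw [signed, Matrix.diagonal_mul, Matrix.mul_diagonal]

theorem diagonal_sgn_mul_self (J : Set ι) :
    Matrix.diagonal (sgn J) * Matrix.diagonal (sgn J) = 1 := by
  rw [Matrix.diagonal_mul_diagonal, ← Matrix.diagonal_one]
  congr 1
  funext i
  exact sgn_mul_self J i

theorem signed_nonneg {J : Set ι} {C : Matrix ι ι ℝ} (h : IsSignSymmetricWith C J) (i j : ι) :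
    0 ≤ signed J C i j := by
  have h1 := h.1 i j
  have h2 := h.2 i j
  have h3 : ¬ ((i ∈ J ∧ j ∉ J) ∨ (i ∉ J ∧ j ∈ J)) → 0 ≤ C i j := fun hn => by
    by_contra hlt
    exact hn (h2 (not_le.1 hlt))
  rw [signed_apply, sgn, sgn]
  by_cases hi : i ∈ J <;> by_cases hj : j ∈ J <;> simp_all

theorem hasExits_signed {J : Set ι} {C : Matrix ι ι ℝ} (h : HasExits C) :
    HasExits (signed J C) := by
  intro S hS hS'
  obtain ⟨i, hi, j, hj, hij⟩ := h S hS hS'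
  refine ⟨i, hi, j, hj, ?_⟩
  rw [signed_apply]
  exact mul_ne_zero (sgn_ne_zero J i) (mul_ne_zero hij (sgn_ne_zero J j))

theorem charpoly_signed (J : Set ι) (C : Matrix ι ι ℝ) : (signed J C).charpoly = C.charpoly := by
  rw [signed, Matrix.charpoly_mul_comm, mul_assoc, diagonal_sgn_mul_self, mul_one]

theorem signed_mulVec (J : Set ι) (C : Matrix ι ι ℝ) (z : ι → ℝ) :
    (signed J C *ᵥ fun i => sgn J i * z i) = fun i => sgn J i * (C *ᵥ z) i := by
  have h : ∀ v : ι → ℝ, (fun i => sgn J i * v i) = Matrix.diagonal (sgn J) *ᵥ v := fun v => by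
    funext i
    rw [Matrix.mulVec_diagonal]
  rw [h, h, signed, Matrix.mulVec_mulVec, mul_assoc, mul_assoc, diagonal_sgn_mul_self, mul_one,
    Matrix.mulVec_mulVec]

end SignSymmetric

/-! ### The group of cube roots of unity -/

section CubeRoots

/-- By `hpair`, {ω, ω⁻¹} is the only pair of distinct elements with product 1, so every other
element of G is its own inverse, that is, ±1. Once -1 is excluded, G = {1, ω, ω⁻¹}, and ω² ∈ G
forces ω³ = 1. -/
theorem mem_iff_pow_three_eq_one {G : Set ℂ} (h0 : (0 : ℂ) ∉ G) (h1 : (1 : ℂ) ∈ G)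
    (hmul : ∀ z ∈ G, ∀ w ∈ G, z * w ∈ G) (hinv : ∀ z ∈ G, z⁻¹ ∈ G)
    (hpair : ∀ z ∈ G, ∀ w ∈ G, ∀ z' ∈ G, ∀ w' ∈ G, z ≠ w → z' ≠ w' → z * w = z' * w' →
      z = z' ∨ z = w')
    {ω : ℂ} (hω : ω ∈ G) (hne : ω ≠ ω⁻¹) (z : ℂ) : z ∈ G ↔ z ^ 3 = 1 := by
  have hn0 : ∀ z ∈ G, z ≠ 0 := fun z hz h => h0 (h ▸ hz)
  have hω0 := hn0 ω hω
  have hω1 : ω ≠ 1 := by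
    rintro rfl
    simp at hne
  have hωm1 : ω ≠ -1 := by
    rintro rfl
    norm_num at hne
  have hcase : ∀ z ∈ G, z ≠ z⁻¹ → z = ω ∨ z = ω⁻¹ := fun z hz hzn =>
    hpair z hz _ (hinv z hz) ω hω _ (hinv ω hω) hzn hne
      (by rw [mul_inv_cancel₀ (hn0 z hz), mul_inv_cancel₀ hω0])
  -- If -1 were in G, the distinct pairs {1, -ω} and {ω, -1} would have the same product.
  have hm1 : (-1 : ℂ) ∉ G := by
    intro hm
    have hmω : -ω ∈ G := by simpa using hmul _ hm _ hω
    have h2 : -ω = ω⁻¹ := by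
      rcases hcase _ hmω (by rw [inv_neg]; exact fun h => hne (neg_injective h)) with h | h
      · exact absurd (self_eq_neg.1 h.symm) hω0
      · exact h
    rcases hpair 1 h1 _ hmω ω hω _ hm (fun h => hωm1 (by rw [h, neg_neg])) hωm1 (by ring)
      with h | h
    · exact hω1 h.symm
    · norm_num at h
  have hG : ∀ z ∈ G, z = 1 ∨ z = ω ∨ z = ω⁻¹ := by
    intro z hz
    by_cases h : z = z⁻¹
    · have h2 : z * z = 1 := by
        nth_rewrite 1 [h]
        exact inv_mul_cancel₀ (hn0 z hz)
      rcases mul_self_eq_one_iff.1 h2 with h | h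
      · exact Or.inl h
      · exact absurd (h ▸ hz) hm1
    · exact Or.inr (hcase z hz h)
  have hω3 : ω ^ 3 = 1 := by
    rcases hG _ (hmul ω hω ω hω) with h | h | h
    · exact absurd (eq_inv_of_mul_eq_one_left h) hne
    · exact absurd (mul_eq_left₀ hω0 |>.1 h) hω1
    · rw [pow_succ, pow_two, h, inv_mul_cancel₀ hω0]
  have hsum : ω ^ 2 + ω + 1 = 0 := by
    have : (ω - 1) * (ω ^ 2 + ω + 1) = 0 := by linear_combination hω3
    exact (mul_eq_zero.1 this).resolve_left (sub_ne_zero.2 hω1)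
  constructor
  · intro hz
    rcases hG z hz with rfl | rfl | rfl
    · norm_num
    · exact hω3
    · rw [inv_pow, hω3, inv_one]
  · intro hz
    have : (z - 1) * ((z - ω) * (z - ω ^ 2)) = 0 := by
      linear_combination hz - hω3 + (-z ^ 2 + z * ω) * hsum
    rcases mul_eq_zero.1 this with h | h
    · rwa [sub_eq_zero.1 h]
    rcases mul_eq_zero.1 h with h | h
    · rwa [sub_eq_zero.1 h]
    · rw [sub_eq_zero.1 h, pow_two]
      exact hmul _ hω _ hω

theorem nodup_nthRoots_three {a : ℂ} (ha : a ≠ 0) : (Polynomial.nthRoots 3 a).Nodup :=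
  (Complex.isPrimitiveRoot_exp 3 (by norm_num)).nthRoots_nodup ha

theorem card_nthRoots_three (r : ℂ) : Multiset.card (Polynomial.nthRoots 3 (r ^ 3)) = 3 := by
  rw [(Complex.isPrimitiveRoot_exp 3 (by norm_num)).card_nthRoots, if_pos ⟨r, rfl⟩]

theorem filter_eq_nthRoots {m : Multiset ℂ} {r : ℝ} (hr : 0 < r)
    [DecidablePred fun z : ℂ => ‖z‖ = r]
    (h : ∀ z, (z ∈ m ∧ ‖z‖ = r) ↔ z ^ 3 = (r : ℂ) ^ 3)
    (hcount : ∀ z ∈ m, ‖z‖ = r → m.count z = 1) :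
    m.filter (fun z => ‖z‖ = r) = Polynomial.nthRoots 3 ((r : ℂ) ^ 3) := by
  have hr0 : (r : ℂ) ^ 3 ≠ 0 := pow_ne_zero 3 (by exact_mod_cast hr.ne')
  rw [Multiset.Nodup.ext _ (nodup_nthRoots_three hr0)]
  · intro z
    rw [Multiset.mem_filter, h, Polynomial.mem_nthRoots (by norm_num)]
  · rw [Multiset.nodup_iff_count_eq_one]
    intro z hz
    rw [Multiset.mem_filter] at hz
    rw [Multiset.count_filter_of_pos (p := fun z : ℂ => ‖z‖ = r) hz.2, hcount z hz.1 hz.2]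

theorem eq_of_count_map_eq_one {κ : Type*} [Fintype κ] {f : κ → ℂ} {i j : κ}
    (h : (Finset.univ.val.map f).count (f i) = 1) (hij : f i = f j) : i = j := by
  classical
  rw [Multiset.count_map] at h
  have h2 : (Finset.univ.filter fun a => f i = f a).card = 1 := h
  exact Finset.card_le_one.1 h2.le i (by simp) j (by simp [hij])

end CubeRoots

/-! ### A single peripheral eigenvalue makes W a linear order -/

/-- If `ρ(A)` is the only peripheral eigenvalue, then the relation `W` is a linear order. -/
theorem isLinearOrderRel_of_peripheral_subset {n : ℕ} [Nontrivial (Fin n)] [Nontrivial (Pairs n)]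
    {A : Matrix (Fin n) (Fin n) ℝ} (hA : ∀ i j, 0 ≤ A i j) (hAirr : HasExits A)
    {J : Set (Pairs n)} (hC : ∀ p q, 0 ≤ signed J (compound A) p q)
    (hCirr : HasExits (signed J (compound A)))
    {t : Fin n → ℂ} (ht : A.charpoly.aroots ℂ = Finset.univ.val.map t)
    (ht2 : (compound A).charpoly.aroots ℂ =
      Finset.univ.val.map fun p : Pairs n => t p.1.1 * t p.1.2)
    {a : Fin n} (hta : t a = specRad A) (hlt : ∀ i, i ≠ a → ‖t i‖ < specRad A) :
    IsLinearOrderRel (wSet J) := by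
  have hρ := specRad_pos hA hAirr
  have hμ := specRad_pos hC hCirr
  obtain ⟨x, hx, hAx⟩ := exists_pos_eigenvector hA hAirr
  obtain ⟨φ, hφ, hCφ⟩ := exists_pos_eigenvector hC hCirr
  have hcount := count_specRad hC hCirr
  rw [charpoly_signed] at hcount
  have hbound : ∀ p : Pairs n, ‖t p.1.1 * t p.1.2‖ ≤ specRad (signed J (compound A)) := by
    intro p
    refine norm_le_specRad _ ?_
    rw [charpoly_signed, ht2]
    exact Multiset.mem_map_of_mem _ (Finset.mem_univ_val p)
  set μ := specRad (signed J (compound A)) with hμdef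
  set ρ := specRad A with hρdef
  have hbound' : ∀ i j, i ≠ j → ‖t i‖ * ‖t j‖ ≤ μ := by
    intro i j hij
    rcases hij.lt_or_gt with h | h
    · simpa using hbound ⟨(i, j), h⟩
    · simpa [mul_comm] using hbound ⟨(j, i), h⟩
  obtain ⟨p, -, hp⟩ : ∃ p ∈ (Finset.univ : Finset (Pairs n)).val, t p.1.1 * t p.1.2 = μ := by
    have : (μ : ℂ) ∈ (compound A).charpoly.aroots ℂ := Multiset.count_pos.1 (by omega)
    rwa [ht2, Multiset.mem_map] at this
  -- A product of maximal modulus must involve ρ: otherwise replacing one factor by ρ would increase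
  -- the modulus.
  obtain ⟨i, hia, hi⟩ : ∃ i, i ≠ a ∧ (ρ : ℂ) * t i = μ := by
    by_cases h1 : p.1.1 = a
    · exact ⟨p.1.2, h1 ▸ p.2.ne', by rw [← hta, ← h1, hp]⟩
    by_cases h2 : p.1.2 = a
    · exact ⟨p.1.1, h2 ▸ p.2.ne, by rw [← hta, ← h2, mul_comm, hp]⟩
    exfalso
    have hn : ‖t p.1.1‖ * ‖t p.1.2‖ = μ := by
      rw [← norm_mul, hp, Complex.norm_real, Real.norm_of_nonneg hμ.le]
    have h3 := hbound' a p.1.2 (Ne.symm h2)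
    rw [hta, Complex.norm_real, Real.norm_of_nonneg hρ.le] at h3
    have h4 : 0 < ‖t p.1.2‖ := (norm_nonneg _).lt_of_ne fun h0 => by
      rw [← h0, mul_zero] at hn
      exact hμ.ne hn
    have := mul_lt_mul_of_pos_right (hlt _ h1) h4
    linarith
  have hρ0 : (ρ : ℂ) ≠ 0 := by exact_mod_cast hρ.ne'
  -- As a quotient of real numbers this eigenvalue is real, so it has a real eigenvector y.
  set s := μ / ρ with hs
  have hts : t i = (s : ℂ) := by
    rw [hs, Complex.ofReal_div, eq_div_iff hρ0, mul_comm, hi]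
  have hsρ : s ≠ ρ := by
    intro h
    have := hlt i hia
    rw [hts, h, Complex.norm_real, Real.norm_of_nonneg hρ.le] at this
    exact lt_irrefl _ this
  have hroot : A.charpoly.IsRoot s := by
    have h1 : (s : ℂ) ∈ A.charpoly.aroots ℂ := by
      rw [ht, ← hts]
      exact Multiset.mem_map_of_mem _ (Finset.mem_univ_val i)
    have h2 := (Polynomial.mem_aroots.1 h1).2
    rw [← Complex.coe_algebraMap, Polynomial.aeval_algebraMap_apply] at h2
    simpa using h2
  obtain ⟨y, hy0, hAy⟩ := (isRoot_charpoly_iff_exists_mulVec A s).1 hroot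
  have hCz : compound A *ᵥ wedge x y = μ • wedge x y := by
    rw [compound_eq_minors, minors_mulVec_wedge, hAx, hAy]
    have : μ = ρ * s := (mul_div_cancel₀ _ hρ.ne').symm
    funext q
    simp only [wedge, Pi.smul_apply, smul_eq_mul, this]
    ring
  obtain ⟨c, hc⟩ := eq_smul_of_mulVec_eq hC hCirr hφ hCφ
    (y := fun q => sgn J q * wedge x y q) (by
      rw [signed_mulVec, hCz]
      funext q
      simp only [Pi.smul_apply, smul_eq_mul]
      ring)
  -- If x ∧ y = 0, then y is a multiple of x and s = ρ.
  have hc0 : c ≠ 0 := by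
    rintro rfl
    have hz : ∀ q, wedge x y q = 0 := fun q => by
      have := congrFun hc q
      rw [zero_smul] at this
      exact (mul_eq_zero.1 this).resolve_left (sgn_ne_zero J q)
    have hxy : ∀ k l, x k * y l = x l * y k := by
      intro k l
      rcases lt_trichotomy k l with h | h | h
      · exact sub_eq_zero.1 (hz ⟨(k, l), h⟩)
      · rw [h]
      · exact (sub_eq_zero.1 (hz ⟨(l, k), h⟩)).symm
    have hyx : y = (y a / x a) • x := by
      funext l
      have := hxy a l
      have := (hx a).ne'
      simp only [Pi.smul_apply, smul_eq_mul]
      field_simp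
      linarith
    have hAy' : A *ᵥ y = ρ • y := by
      rw [hyx, Matrix.mulVec_smul, hAx, smul_comm]
    rw [hAy'] at hAy
    exact hsρ (smul_left_injective ℝ hy0 hAy).symm
  -- Dividing x_i y_j - x_j y_i by x_i x_j > 0 gives a difference of ratios. The factor c makes the
  -- sign independent of the orientation of y.
  have hkey : ∀ q : Pairs n,
      0 < sgn J q * (c * (y q.1.2 / x q.1.2) - c * (y q.1.1 / x q.1.1)) := by
    intro q
    have h1 : sgn J q * (x q.1.1 * y q.1.2 - x q.1.2 * y q.1.1) = c * φ q := congrFun hc q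
    have h2 := hx q.1.1
    have h3 := hx q.1.2
    have h4 : sgn J q * (c * (y q.1.2 / x q.1.2) - c * (y q.1.1 / x q.1.1)) =
        c * (sgn J q * (x q.1.1 * y q.1.2 - x q.1.2 * y q.1.1)) / (x q.1.1 * x q.1.2) := by
      field_simp
    rw [h4, h1, ← mul_assoc]
    exact div_pos (mul_pos (mul_self_pos.2 hc0) (hφ q)) (mul_pos h2 h3)
  refine isLinearOrderRel_of_ranking (fun k => c * (y k / x k)) (fun q hq => ?_) fun q hq => ?_
  · have := hkey q
    rw [sgn, if_pos hq] at this
    linarith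
  · have := hkey q
    rw [sgn, if_neg hq] at this
    linarith

end SecondCompound

/-! ### The peripheral spectra of A and A ∧ A -/

open SecondCompound in
theorem theorem14 (n : ℕ) (A : Matrix (Fin n) (Fin n) ℝ)
    (hA_nonneg : ∀ i j, 0 ≤ A i j)
    (hA_irred : ¬ SecondCompound.IsReducible A)
    (J : Set (SecondCompound.Pairs n))
    (hJ : SecondCompound.IsSignSymmetricWith (SecondCompound.compound A) J)
    (hA2_irred : ¬ SecondCompound.IsReducible (SecondCompound.compound A))
    (hW : ¬ SecondCompound.IsLinearOrderRel (SecondCompound.wSet J)) :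
    -- `ρ(A) > 0` is an eigenvalue with a positive eigenvector
    (0 < SecondCompound.rho (Matrix.toLin' A) ∧
      ∃ x : Fin n → ℝ, (∀ i, 0 < x i) ∧
        Module.End.HasEigenvector (Matrix.toLin' A)
          (SecondCompound.rho (Matrix.toLin' A)) x) ∧
    -- there are exactly three eigenvalues on the spectral circle
    {z : ℂ | z ∈ SecondCompound.eigs (Matrix.toLin' A) ∧
      ‖z‖ = SecondCompound.rho (Matrix.toLin' A)}.ncard = 3 ∧
    -- each of them is simple
    (∀ z ∈ SecondCompound.eigs (Matrix.toLin' A),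
      ‖z‖ = SecondCompound.rho (Matrix.toLin' A) →
        (SecondCompound.eigs (Matrix.toLin' A)).count z = 1) ∧
    -- they are the cube roots of `ρ(A)³`
    (∀ z : ℂ, (z ∈ SecondCompound.eigs (Matrix.toLin' A) ∧
      ‖z‖ = SecondCompound.rho (Matrix.toLin' A)) ↔
        z ^ 3 = (SecondCompound.rho (Matrix.toLin' A) : ℂ) ^ 3) ∧
    -- the indices of imprimitivity of `A` and `A ∧ A` are both `3`
    SecondCompound.imprimitivityIndex (Matrix.toLin' A) = 3 ∧
    SecondCompound.imprimitivityIndex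
      (SecondCompound.exteriorSquare (Matrix.toLin' A)) = 3 := by
  have hP := nontrivial_pairs_of_not_isLinearOrderRel hW
  have hF : Nontrivial (Fin n) := by
    obtain ⟨p⟩ := hP.to_nonempty
    exact ⟨_, _, p.2.ne⟩
  have hAirr := hasExits_of_not_isReducible hA_irred
  have hC := signed_nonneg hJ
  have hCirr := hasExits_signed (J := J) (hasExits_of_not_isReducible hA2_irred)
  have hρ := specRad_pos hA_nonneg hAirr
  have hμ := specRad_pos hC hCirr
  obtain ⟨x, hx, hAx⟩ := exists_pos_eigenvector hA_nonneg hAirr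
  obtain ⟨t, ht, ht2⟩ := exists_aroots_charpoly_eq A
  have hsimple := fun c => count_eq_one_of_norm_eq_specRad (c := c) hA_nonneg hAirr hρ
  have hsimple2 := fun c => count_eq_one_of_norm_eq_specRad (c := c) hC hCirr hμ
  have hrot := fun c => map_mul_aroots_charpoly (c := c) hA_nonneg hAirr hρ
  have hρcount := count_specRad hA_nonneg hAirr
  have hμcount := count_specRad hC hCirr
  have hle := fun z => norm_le_specRad (z := z) A
  have hle2 := fun z => norm_le_specRad (z := z) (signed J (compound A))
  obtain ⟨c2, hc2, hc2n⟩ := exists_norm_eq_specRad (signed J (compound A))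
  rw [charpoly_signed] at hsimple2 hμcount hle2 hc2
  have hlin := fun a => isLinearOrderRel_of_peripheral_subset (a := a) hA_nonneg hAirr hC hCirr ht ht2
  have heig : eigs (Matrix.toLin' A) = A.charpoly.aroots ℂ :=
    eigs_eq_aroots (Matrix.charpoly_toLin' A)
  have heig2 : eigs (exteriorSquare (Matrix.toLin' A)) = (compound A).charpoly.aroots ℂ :=
    eigs_eq_aroots (charpoly_exteriorSquare A)
  have hrho : rho (Matrix.toLin' A) = specRad A := rho_eq_specRad (Matrix.charpoly_toLin' A)
  have hrho2 : rho (exteriorSquare (Matrix.toLin' A)) = specRad (signed J (compound A)) :=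
    rho_eq_specRad ((charpoly_exteriorSquare A).trans (charpoly_signed J _).symm)
  rw [imprimitivityIndex, imprimitivityIndex, peripheral, peripheral, hrho, hrho2, heig, heig2]
  set ρ := specRad A with hρdef
  set μ := specRad (signed J (compound A)) with hμdef
  have hρ0 : (ρ : ℂ) ≠ 0 := by exact_mod_cast hρ.ne'
  have hmem : ∀ z, z ∈ A.charpoly.aroots ℂ ↔ ∃ i, t i = z := fun z => by
    rw [ht, Multiset.mem_map]
    simp
  have hmem2 : ∀ z, z ∈ (compound A).charpoly.aroots ℂ ↔ ∃ i j, i ≠ j ∧ t i * t j = z := fun z => by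
    rw [ht2, Multiset.mem_map]
    constructor
    · rintro ⟨p, -, hp⟩
      exact ⟨_, _, p.2.ne, hp⟩
    · rintro ⟨i, j, hij, h⟩
      rcases hij.lt_or_gt with h' | h'
      · exact ⟨⟨(i, j), h'⟩, Finset.mem_univ_val _, h⟩
      · exact ⟨⟨(j, i), h'⟩, Finset.mem_univ_val _, by rw [mul_comm]; exact h⟩
  have htle : ∀ i, ‖t i‖ ≤ ρ := fun i => hle _ ((hmem _).2 ⟨i, rfl⟩)
  have hinj : ∀ i j, ‖t i‖ = ρ → t i = t j → i = j := fun i j hi hij => by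
    have := hsimple _ ((hmem _).2 ⟨i, rfl⟩) hi
    rw [ht] at this
    exact eq_of_count_map_eq_one this hij
  -- Simplicity of the peripheral eigenvalues of the compound: equal products come from the same
  -- unordered pair of indices.
  have hinj2 : ∀ i j k l, i ≠ j → k ≠ l → ‖t i * t j‖ = μ → t i * t j = t k * t l →
      i = k ∨ i = l := by
    have key : ∀ p q : Pairs n, ‖t p.1.1 * t p.1.2‖ = μ →
        t p.1.1 * t p.1.2 = t q.1.1 * t q.1.2 → p = q := fun p q hn hpq => by
      have := hsimple2 _ ((hmem2 _).2 ⟨_, _, p.2.ne, rfl⟩) hn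
      rw [ht2] at this
      exact eq_of_count_map_eq_one (f := fun p : Pairs n => t p.1.1 * t p.1.2) this hpq
    intro i j k l hij hkl hn h
    rcases hij.lt_or_gt with h1 | h1 <;> rcases hkl.lt_or_gt with h2 | h2
    · exact Or.inl (congrArg (fun p => p.1.1) (key ⟨(i, j), h1⟩ ⟨(k, l), h2⟩ hn h))
    · exact Or.inr (congrArg (fun p => p.1.1)
        (key ⟨(i, j), h1⟩ ⟨(l, k), h2⟩ hn (h.trans (mul_comm _ _))))
    · exact Or.inr (congrArg (fun p => p.1.2)
        (key ⟨(j, i), h1⟩ ⟨(k, l), h2⟩ (by rwa [mul_comm]) ((mul_comm _ _).trans h)))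
    · exact Or.inl (congrArg (fun p => p.1.2) (key ⟨(j, i), h1⟩ ⟨(l, k), h2⟩ (by rwa [mul_comm])
        ((mul_comm _ _).trans (h.trans (mul_comm _ _)))))
  obtain ⟨a, ha⟩ := (hmem ρ).1 (Multiset.count_pos.1 (by omega))
  obtain ⟨b, hba, hb⟩ : ∃ b, b ≠ a ∧ ‖t b‖ = ρ := by
    by_contra! h
    exact hW (hlin a ha fun i hi => (htle i).lt_of_ne (h i hi))
  have hna : ‖t a‖ = ρ := by rw [ha, Complex.norm_real, Real.norm_of_nonneg hρ.le]
  have hμρ : μ = ρ ^ 2 := by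
    refine le_antisymm ?_ ?_
    · obtain ⟨i, j, -, hij⟩ := (hmem2 _).1 hc2
      rw [← hc2n, ← hij, norm_mul, pow_two]
      exact mul_le_mul (htle i) (htle j) (norm_nonneg _) hρ.le
    · have := hle2 _ ((hmem2 _).2 ⟨a, b, hba.symm, rfl⟩)
      rwa [norm_mul, hna, hb, ← pow_two] at this
  have hboth : ∀ i j, ‖t i * t j‖ = μ → ‖t i‖ = ρ ∧ ‖t j‖ = ρ := by
    have key : ∀ i j, ‖t i * t j‖ = μ → ‖t i‖ = ρ := fun i j h => by
      rw [norm_mul, hμρ, pow_two] at h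
      refine le_antisymm (htle i) (le_of_mul_le_mul_right ?_ hρ)
      rw [← h]
      exact mul_le_mul_of_nonneg_left (htle j) (norm_nonneg _)
    exact fun i j h => ⟨key i j h, key j i (by rwa [mul_comm])⟩
  set G : Set ℂ := {z | ‖z‖ = 1 ∧ ∃ i, t i = ρ * z} with hG
  have hGi : ∀ i, ‖t i‖ = ρ → t i / ρ ∈ G := fun i hi =>
    ⟨by rw [norm_div, hi, Complex.norm_real, Real.norm_of_nonneg hρ.le, div_self hρ.ne'],
      i, (mul_div_cancel₀ _ hρ0).symm⟩
  have hnG : ∀ z i, ‖z‖ = 1 → t i = ρ * z → ‖t i‖ = ρ := fun z i hz hi => by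
    rw [hi, norm_mul, hz, Complex.norm_real, Real.norm_of_nonneg hρ.le, mul_one]
  obtain ⟨i₀, j₀, hij₀, hprod⟩ := (hmem2 μ).1 (Multiset.count_pos.1 (by omega))
  have hprodn : ‖t i₀ * t j₀‖ = μ := by
    rw [hprod, Complex.norm_real, Real.norm_of_nonneg hμ.le]
  -- Since t i₀ * t j₀ = ρ², a self-inverse t i₀ / ρ would give t i₀ = t j₀ with i₀ ≠ j₀, against
  -- simplicity for A.
  have hω : t i₀ / ρ ≠ (t i₀ / ρ)⁻¹ := by
    intro h
    refine hij₀ (hinj i₀ j₀ (hboth _ _ hprodn).1 ?_)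
    have hi0 : t i₀ ≠ 0 := fun h0 => by
      have := (hboth _ _ hprodn).1
      rw [h0, norm_zero] at this
      exact hρ.ne this
    rw [hμρ, Complex.ofReal_pow] at hprod
    rw [inv_div, div_eq_div_iff hρ0 hi0, ← pow_two (ρ : ℂ), ← hprod] at h
    exact mul_left_cancel₀ hi0 h
  have hcube : ∀ z, z ∈ G ↔ z ^ 3 = 1 := by
    refine mem_iff_pow_three_eq_one (fun h => by simpa using h.1)
      ⟨norm_one, a, by rw [ha, mul_one]⟩ ?_ ?_ ?_ (hGi i₀ (hboth _ _ hprodn).1) hω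
    -- Rotation by z preserves the spectrum: it sends ρw to ρzw, and, for inverses, some eigenvalue
    -- is sent to ρ.
    · rintro z ⟨hz, i, hi⟩ w ⟨hw, j, hj⟩
      refine ⟨by rw [norm_mul, hz, hw, one_mul], (hmem _).1 ?_⟩
      rw [← hrot _ ((hmem _).2 ⟨i, rfl⟩) (hnG z i hz hi), Multiset.mem_map]
      refine ⟨t j, (hmem _).2 ⟨j, rfl⟩, ?_⟩
      rw [hi, hj]
      field_simp
    · rintro z ⟨hz, i, hi⟩
      have hz0 : z ≠ 0 := fun h => by simp [h] at hz
      refine ⟨by rw [norm_inv, hz, inv_one], ?_⟩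
      have h1 := (hmem ρ).2 ⟨a, ha⟩
      rw [← hrot _ ((hmem _).2 ⟨i, rfl⟩) (hnG z i hz hi), Multiset.mem_map] at h1
      obtain ⟨w, hw, h⟩ := h1
      obtain ⟨k, rfl⟩ := (hmem w).1 hw
      refine ⟨k, ?_⟩
      rw [hi, mul_div_cancel_left₀ _ hρ0] at h
      rw [← h]
      field_simp
    · rintro z ⟨hz, i, hi⟩ w ⟨hw, j, hj⟩ z' ⟨hz', k, hk⟩ w' ⟨hw', l, hl⟩ hzw hzw' h
      have h1 := hinj2 i j k l (fun h => hzw (mul_left_cancel₀ hρ0 (by rw [← hi, h, hj])))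
        (fun h => hzw' (mul_left_cancel₀ hρ0 (by rw [← hk, h, hl])))
        (by rw [norm_mul, hnG z i hz hi, hnG w j hw hj, hμρ, pow_two])
        (by rw [hi, hj, hk, hl]; linear_combination (ρ : ℂ) ^ 2 * h)
      rcases h1 with rfl | rfl
      · exact Or.inl (mul_left_cancel₀ hρ0 (hi.symm.trans hk))
      · exact Or.inr (mul_left_cancel₀ hρ0 (hi.symm.trans hl))
  have hiff : ∀ z : ℂ, (z ∈ A.charpoly.aroots ℂ ∧ ‖z‖ = ρ) ↔ z ^ 3 = (ρ : ℂ) ^ 3 := by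
    intro z
    have h1 : z ^ 3 = (ρ : ℂ) ^ 3 ↔ (z / ρ) ^ 3 = 1 := by
      rw [div_pow, div_eq_one_iff_eq (pow_ne_zero 3 hρ0)]
    rw [h1, ← hcube]
    constructor
    · rintro ⟨hz, hn⟩
      obtain ⟨i, rfl⟩ := (hmem z).1 hz
      exact hGi i hn
    · rintro ⟨hn, i, hi⟩
      have hiz : t i = z := by rw [hi, mul_div_cancel₀ _ hρ0]
      exact ⟨(hmem z).2 ⟨i, hiz⟩, by rw [← hiz]; exact hnG _ i hn hi⟩
  have hiff2 : ∀ z : ℂ, (z ∈ (compound A).charpoly.aroots ℂ ∧ ‖z‖ = μ) ↔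
      z ^ 3 = (μ : ℂ) ^ 3 := by
    intro z
    constructor
    · rintro ⟨hz, hn⟩
      obtain ⟨i, j, -, rfl⟩ := (hmem2 z).1 hz
      have h1 := (hiff _).1 ⟨(hmem _).2 ⟨i, rfl⟩, (hboth i j hn).1⟩
      have h2 := (hiff _).1 ⟨(hmem _).2 ⟨j, rfl⟩, (hboth i j hn).2⟩
      rw [mul_pow, h1, h2, hμρ, Complex.ofReal_pow]
      ring
    · intro hz
      obtain ⟨ω, hω3, hω⟩ : ∃ ω : ℂ, ω ^ 3 = 1 ∧ ω ≠ ω⁻¹ :=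
        ⟨_, (hcube _).1 (hGi i₀ (hboth _ _ hprodn).1), hω⟩
      have hω0 : ω ≠ 0 := fun h => by simp [h] at hω3
      obtain ⟨ζ, hζ⟩ : ∃ ζ, z = ρ ^ 2 * ζ := ⟨_, (mul_div_cancel₀ _ (pow_ne_zero 2 hρ0)).symm⟩
      have hζ3 : ζ ^ 3 = 1 := by
        rw [hζ, mul_pow, hμρ, Complex.ofReal_pow] at hz
        exact (mul_eq_left₀ (pow_ne_zero 3 (pow_ne_zero 2 hρ0))).1 hz
      have hζ0 : ζ ≠ 0 := fun h => by simp [h] at hζ3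
      -- The cube roots ζ²ω and ζ²ω⁻¹ are distinct and have product ζ⁴ = ζ.
      obtain ⟨hn1, i, hi⟩ := (hcube (ζ ^ 2 * ω)).2
        (by linear_combination (ζ ^ 3 + 1) * ω ^ 3 * hζ3 + hω3)
      obtain ⟨hn2, j, hj⟩ := (hcube (ζ ^ 2 * ω⁻¹)).2
        (by rw [mul_pow, inv_pow, hω3, inv_one, mul_one]; linear_combination (ζ ^ 3 + 1) * hζ3)
      have hz' : t i * t j = z := by
        rw [hi, hj, hζ]
        calc (ρ : ℂ) * (ζ ^ 2 * ω) * (ρ * (ζ ^ 2 * ω⁻¹)) = ρ ^ 2 * (ζ ^ 3 * ζ) * (ω * ω⁻¹) := by ring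
          _ = _ := by rw [hζ3, mul_inv_cancel₀ hω0, one_mul, mul_one]
      refine ⟨(hmem2 z).2 ⟨i, j, ?_, hz'⟩, ?_⟩
      · rintro rfl
        exact hω (mul_left_cancel₀ (pow_ne_zero 2 hζ0) (mul_left_cancel₀ hρ0 (hi.symm.trans hj)))
      · rw [← hz', norm_mul, hnG _ i hn1 hi, hnG _ j hn2 hj, hμρ, pow_two]
  refine ⟨⟨hρ, x, hx, ?_⟩, ?_, fun z hz => hsimple z hz, hiff, ?_, ?_⟩
  · rw [Module.End.hasEigenvector_iff, Module.End.mem_eigenspace_iff]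
    refine ⟨by simpa using hAx, fun h => ?_⟩
    exact (hx a).ne' (congrFun h a)
  · have hset : {z : ℂ | z ∈ A.charpoly.aroots ℂ ∧ ‖z‖ = ρ} =
        ((Polynomial.nthRoots 3 ((ρ : ℂ) ^ 3)).toFinset : Set ℂ) := by
      ext z
      simp only [Set.mem_ofPred_eq, hiff, Finset.mem_coe, Multiset.mem_toFinset]
      rw [Polynomial.mem_nthRoots (by norm_num)]
    rw [hset, Set.ncard_coe_finset,
      Multiset.toFinset_card_of_nodup (nodup_nthRoots_three (pow_ne_zero 3 hρ0)),
      card_nthRoots_three]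
  · rw [filter_eq_nthRoots hρ hiff fun z => hsimple z, card_nthRoots_three]
  · rw [filter_eq_nthRoots hμ hiff2 fun z => hsimple2 z, card_nthRoots_three]
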